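/- A sum-product network (SPN) over binary variables $(x_i)_{i\in I}$ is a finite rooted directed acyclic graph whose leaves are indicators $\mathbb 1[x_i=0]$, $\mathbb 1[x_i=1]$ and whose internal nodes compute either a sum of their children with positive weights or the product of their children; its output is the value at the root, and its size is the number of its internal nodes. The scope of a node is the set of variables whose indicators lie at or below it. The SPN is complete if all children of each sum node have the same scope, and decomposable if distinct children of each product node have disjoint scopes. For $M\in\mathbb N$ let $\mathbf E=(E_{ij})_{1\le i<j\le M}$ be binary variables encoding a graph on $M$ vertices (the edge $\{i,j\}$ is present iff $E_{ij}=1$). A strictly positive distribution on triangle-free graphs on $M$ vertices is a probability function $d(\mathbf E)$ such that $d(\mathbf E)>0$ if and only if the graph encoded by $\mathbf E$ contains no triangle. Theorem. There are constants $c>0$ and $M_0\in\mathbb N$ such that the following holds for every $M\ge M_0$, every strictly positive distribution $d$ on triangle-free graphs on $M$ vertices and every $s\in\mathbb N$. If $d$ can be approximated arbitrarily well by decomposable and complete SPNs of size at most $s$, i.e. if for every $\varepsilon>0$ there is such an SPN whose output $\Psi$ satisfies $|\Psi(\mathbf E)-d(\mathbf E)|<\varepsilon$ for all $\mathbf E\in\{0,1\}^{\binom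 M2}$, then $s\ge 2^{cM}$. In short, $s\ge 2^{\Omega(M)}$. -/

import Mathlib

/-- The possible types of a node of a sum-product network over variables indexed by `ι`:
the indicator `𝟙[x i = b]`, a weighted sum, or a product. -/
inductive SPNLabel (ι : Type) : Type
  | indicator (i : ι) (b : Bool) : SPNLabel ι
  | sum : SPNLabel ι
  | prod : SPNLabel ι

/-- A sum-product network over binary variables indexed by `ι`: a finite rooted directed acyclic
graph whose leaves are indicators and whose internal nodes are (positively) weighted sums and
products. The weights need not be normalized. -/
structure SPN (ι : Type) where
  /-- the nodes -/
  V : Type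
  finite_V : Finite V
  /-- the type of a node -/
  label : V → SPNLabel ι
  /-- the children (inputs) of a node -/
  children : V → Finset V
  /-- `weight v c` is the weight of the child `c` of the sum node `v` (irrelevant elsewhere) -/
  weight : V → V → ℝ
  /-- the root (output) -/
  root : V
  /-- the graph has no directed cycle -/
  acyclic : ∀ v, ¬ Relation.TransGen (fun c u => c ∈ children u) v v
  /-- every node is reached from the root -/
  rooted : ∀ v, Relation.ReflTransGen (fun c u => c ∈ children u) v root
  /-- the leaves are exactly the indicator nodes -/
  leaf_iff : ∀ v, children v = ∅ ↔ ∃ i b, label v = SPNLabel.indicator i b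
  /-- the weights of sum nodes are positive -/
  weight_pos : ∀ v, label v = SPNLabel.sum → ∀ c ∈ children v, 0 < weight v c

namespace SPN

theorem wf {ι : Type} (Φ : SPN ι) : WellFounded (fun c v => c ∈ Φ.children v) := by
  have := Φ.finite_V
  have : Std.Irrefl (Relation.TransGen (fun c v => c ∈ Φ.children v)) := ⟨Φ.acyclic⟩
  have h : WellFounded (Relation.TransGen (fun c v => c ∈ Φ.children v)) :=
    Finite.wellFounded_of_trans_of_irrefl _
  exact Subrelation.wf (fun {_ _} hab => Relation.TransGen.single hab) h

/-- The scope of a node: the variables whose indicators lie below it. -/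
noncomputable def scope {ι : Type} (Φ : SPN ι) : Φ.V → Set ι :=
  Φ.wf.fix fun v ih =>
    match Φ.label v with
    | SPNLabel.indicator i _ => {i}
    | _ => ⋃ c : {c // c ∈ Φ.children v}, ih c.1 c.2

theorem scope_eq {ι : Type} (Φ : SPN ι) (v : Φ.V) :
    Φ.scope v = match Φ.label v with
      | SPNLabel.indicator i _ => {i}
      | _ => ⋃ c ∈ Φ.children v, Φ.scope c := by
  rw [scope, WellFounded.fix_eq]
  split <;> simp [Set.iUnion_subtype]

/-- The function computed at each node on evidence `x`, where `x i = none` means that the `i`-th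
variable is missing (marginalized), in which case all of its indicators are `1`. -/
noncomputable def eval {ι : Type} (Φ : SPN ι) (x : ι → Option Bool) : Φ.V → ℝ :=
  Φ.wf.fix fun v ih =>
    match Φ.label v with
    | SPNLabel.indicator i b => if x i = none ∨ x i = some b then 1 else 0
    | SPNLabel.sum => ∑ c : {c // c ∈ Φ.children v}, Φ.weight v c.1 * ih c.1 c.2
    | SPNLabel.prod => ∏ c : {c // c ∈ Φ.children v}, ih c.1 c.2

theorem eval_eq {ι : Type} (Φ : SPN ι) (x : ι → Option Bool) (v : Φ.V) :
    Φ.eval x v = match Φ.label v with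
      | SPNLabel.indicator i b => if x i = none ∨ x i = some b then 1 else 0
      | SPNLabel.sum => ∑ c ∈ Φ.children v, Φ.weight v c * Φ.eval x c
      | SPNLabel.prod => ∏ c ∈ Φ.children v, Φ.eval x c := by
  rw [eval, WellFounded.fix_eq]
  split
  · rfl
  · exact Finset.sum_coe_sort (Φ.children v) (fun c => Φ.weight v c * Φ.eval x c)
  · exact Finset.prod_coe_sort (Φ.children v) (fun c => Φ.eval x c)

/-- The output of the network on complete evidence. -/
noncomputable def output {ι : Type} (Φ : SPN ι) (x : ι → Bool) : ℝ :=
  Φ.eval (fun i => some (x i)) Φ.root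

/-- Completeness: all children of a sum node have the same scope. -/
def IsComplete {ι : Type} (Φ : SPN ι) : Prop :=
  ∀ v, Φ.label v = SPNLabel.sum →
    ∀ c₁ ∈ Φ.children v, ∀ c₂ ∈ Φ.children v, Φ.scope c₁ = Φ.scope c₂

/-- Decomposability: distinct children of a product node have disjoint scopes. -/
def IsDecomposable {ι : Type} (Φ : SPN ι) : Prop :=
  ∀ v, Φ.label v = SPNLabel.prod →
    ∀ c₁ ∈ Φ.children v, ∀ c₂ ∈ Φ.children v, c₁ ≠ c₂ → Disjoint (Φ.scope c₁) (Φ.scope c₂)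

/-- The size of a network: the number of its internal (sum and product) nodes. -/
noncomputable def size {ι : Type} (Φ : SPN ι) : ℕ :=
  Nat.card {v : Φ.V // Φ.label v = SPNLabel.sum ∨ Φ.label v = SPNLabel.prod}

end SPN

/-- `f` can be approximated arbitrarily well by decomposable and complete networks of size at
most `s`. -/
def ApproximableBySPN {ι : Type} (f : (ι → Bool) → ℝ) (s : ℕ) : Prop :=
  ∀ ε : ℝ, 0 < ε → ∃ Φ : SPN ι, Φ.IsDecomposable ∧ Φ.IsComplete ∧ Φ.size ≤ s ∧
    ∀ x, |Φ.output x - f x| < ε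

/-- The potential edges `{i, j}`, `i < j`, of a graph on `M` vertices. -/
abbrev EdgeVar (M : ℕ) : Type := {p : Fin M × Fin M // p.1 < p.2}

/-- The graph with edge indicators `E` has no triangle. -/
def TriangleFree {M : ℕ} (E : EdgeVar M → Bool) : Prop :=
  ∀ (i₁ i₂ i₃ : Fin M) (h₁₂ : i₁ < i₂) (h₂₃ : i₂ < i₃),
    E ⟨(i₁, i₂), h₁₂⟩ = false ∨ E ⟨(i₂, i₃), h₂₃⟩ = false ∨
      E ⟨(i₁, i₃), h₁₂.trans h₂₃⟩ = false

/-- `d` is a probability function on graphs on `M` vertices that is positive exactly at the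
triangle-free graphs. -/
structure IsStrictlyPositiveTriangleFreeDist {M : ℕ} (d : (EdgeVar M → Bool) → ℝ) : Prop where
  nonneg : ∀ E, 0 ≤ d E
  sum_eq_one : ∑ E, d E = 1
  pos_iff : ∀ E, 0 < d E ↔ TriangleFree E

/-! Follow large nodes (scope above two thirds of the variables) down a complete decomposable
network until a product node has no large child. Expanding along these nodes writes the output as a
sum of at most `size` terms, one per such product node. Each term is a product of two nonnegative
functions, one on each side of a balanced partition of the edge variables
(`exists_balanced_decomposition`).

If two graphs both have a non-negligible value in one term, swapping their halves along the
partition preserves the product of the two values. So neither hybrid can have output close to zero,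
and both are triangle-free. Since the output is bounded below on triangle-free graphs, each of them
is non-negligible in some term: at most `s` families with triangle-free crossings cover all
triangle-free graphs (`exists_crossing_cover`). One `ε`, chosen from `s` and the minimum of `d` on
these graphs, suffices; no limit is taken.

Such covers are exponentially large (`pow_le_card_of_crossing_cover`). Colour the edges by the two
sides. A constant fraction of the vertex triples is not monochromatic, so one of the three edges has
its own colour. The path omitting this edge and a path containing it recombine into a triangle, so a
family loses at least one of the three paths on the triple (`midpoint_eq_of_crossing`). Disjoint
triples are chosen so that, averaged over the families, at most `(95/32)^m` of the `3^m` unions of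
paths survive. -/

namespace SPN

/-! ### Values and scopes of nodes -/

variable {ι : Type}

theorem eval_nonneg (Φ : SPN ι) (x : ι → Option Bool) (v : Φ.V) : 0 ≤ Φ.eval x v := by
  induction v using Φ.wf.induction with
  | _ v ih =>
    rw [eval_eq]
    split
    · split_ifs <;> norm_num
    · next h =>
      exact Finset.sum_nonneg fun c hc => mul_nonneg (Φ.weight_pos v h c hc).le (ih c hc)
    · exact Finset.prod_nonneg fun c hc => ih c hc

theorem scope_subset_of_mem_children (Φ : SPN ι) {v c : Φ.V} (hc : c ∈ Φ.children v) :
    Φ.scope c ⊆ Φ.scope v := by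
  rw [Φ.scope_eq v]
  split
  · next h =>
    have := (Φ.leaf_iff v).2 ⟨_, _, h⟩
    simp [this] at hc
  · exact Set.subset_biUnion_of_mem (u := fun c => Φ.scope c) hc

/-- The value of a node on complete evidence. -/
noncomputable def value (Φ : SPN ι) (v : Φ.V) (x : ι → Bool) : ℝ :=
  Φ.eval (fun i => some (x i)) v

theorem value_nonneg (Φ : SPN ι) (v : Φ.V) (x : ι → Bool) : 0 ≤ Φ.value v x :=
  Φ.eval_nonneg _ v

theorem value_of_sum (Φ : SPN ι) {v : Φ.V} (h : Φ.label v = SPNLabel.sum) (x : ι → Bool) :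
    Φ.value v x = ∑ c ∈ Φ.children v, Φ.weight v c * Φ.value c x := by
  simp only [value]
  rw [eval_eq, h]

theorem value_of_prod (Φ : SPN ι) {v : Φ.V} (h : Φ.label v = SPNLabel.prod) (x : ι → Bool) :
    Φ.value v x = ∏ c ∈ Φ.children v, Φ.value c x := by
  simp only [value]
  rw [eval_eq, h]

theorem dependsOn_value (Φ : SPN ι) (v : Φ.V) : DependsOn (Φ.value v) (Φ.scope v) := by
  induction v using Φ.wf.induction with
  | _ v ih =>
    intro x y hxy
    rcases h : Φ.label v with ⟨i, b⟩ | _ | _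
    · have hi : i ∈ Φ.scope v := by rw [scope_eq, h]; rfl
      simp only [value]
      rw [eval_eq, eval_eq, h]
      simp [hxy i hi]
    · rw [Φ.value_of_sum h, Φ.value_of_sum h]
      refine Finset.sum_congr rfl fun c hc => ?_
      rw [ih c hc fun i hi => hxy i (Φ.scope_subset_of_mem_children hc hi)]
    · rw [Φ.value_of_prod h, Φ.value_of_prod h]
      refine Finset.prod_congr rfl fun c hc => ?_
      rw [ih c hc fun i hi => hxy i (Φ.scope_subset_of_mem_children hc hi)]

theorem IsComplete.scope_eq_of_mem_children {Φ : SPN ι} (hΦ : Φ.IsComplete) {v c : Φ.V}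
    (h : Φ.label v = SPNLabel.sum) (hc : c ∈ Φ.children v) : Φ.scope c = Φ.scope v := by
  refine (Φ.scope_subset_of_mem_children hc).antisymm ?_
  rw [Φ.scope_eq v, h]
  exact Set.iUnion₂_subset fun c' hc' => (hΦ v h c' hc' c hc).subset

/-! ### Balanced product decompositions -/

/-- A product node with a large scope all of whose children have a scope that is not large. -/
structure IsCritical (Φ : SPN ι) (n : ℕ) (v : Φ.V) : Prop where
  label_eq : Φ.label v = SPNLabel.prod
  large : 2 * n < 3 * (Φ.scope v).ncard
  children_le : ∀ c ∈ Φ.children v, 3 * (Φ.scope c).ncard ≤ 2 * n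

/-- Completeness passes largeness on to every child of a sum node. A product node is either critical
or has a large child to follow, and the siblings of that child go into the coefficient.
Decomposability keeps them off the scope of the child, so `q v` never sees the variables of `v`. -/
theorem exists_sum_critical (Φ : SPN ι) [Fintype Φ.V] (hD : Φ.IsDecomposable)
    (hC : Φ.IsComplete) {n : ℕ} (hn : 2 ≤ n) (u : Φ.V) (hu : 2 * n < 3 * (Φ.scope u).ncard) :
    ∃ q : Φ.V → (ι → Bool) → ℝ, (∀ v x, 0 ≤ q v x) ∧
      (∀ v, q v ≠ 0 → Φ.IsCritical n v ∧ Φ.scope v ⊆ Φ.scope u) ∧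
      (∀ v, DependsOn (q v) (Φ.scope v)ᶜ) ∧
      ∀ x, Φ.value u x = ∑ v, q v x * Φ.value v x := by
  classical
  induction u using Φ.wf.induction with
  | _ u ih =>
    rcases h : Φ.label u with ⟨i, b⟩ | _ | _
    -- A leaf has a single variable, which is not large because `2 ≤ n`.
    · rw [scope_eq, h] at hu
      simp at hu
      omega
    · have hsc : ∀ c ∈ Φ.children u, Φ.scope c = Φ.scope u := fun c hc =>
        hC.scope_eq_of_mem_children h hc
      have hlarge : ∀ c ∈ Φ.children u, 2 * n < 3 * (Φ.scope c).ncard := fun c hc => by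
        rw [hsc c hc]; exact hu
      choose! q hq0 hq1 hq2 hq3 using fun c hc => ih c hc (hlarge c hc)
      refine ⟨fun v x => ∑ c ∈ Φ.children u, Φ.weight u c * q c v x, fun v x => ?_,
        fun v hv => ?_, fun v x y hxy => ?_, fun x => ?_⟩
      · exact Finset.sum_nonneg fun c hc => mul_nonneg (Φ.weight_pos u h c hc).le (hq0 c hc v x)
      · by_contra hcon
        apply hv
        funext x
        refine Finset.sum_eq_zero fun c hc => ?_
        have : q c v = 0 := by
          by_contra hne
          have := hq1 c hc v hne
          rw [hsc c hc] at this
          exact hcon this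
        simp [this]
      · exact Finset.sum_congr rfl fun c hc => by rw [hq2 c hc v hxy]
      · rw [Φ.value_of_sum h]
        simp only [Finset.sum_mul]
        rw [Finset.sum_comm]
        refine Finset.sum_congr rfl fun c hc => ?_
        rw [hq3 c hc x, Finset.mul_sum]
        exact Finset.sum_congr rfl fun v _ => by ring
    · by_cases hcr : ∀ c ∈ Φ.children u, 3 * (Φ.scope c).ncard ≤ 2 * n
      · refine ⟨fun v _ => if v = u then 1 else 0, fun v x => ?_, fun v hv => ?_,
          fun v x y _ => rfl, fun x => ?_⟩
        · dsimp only
          split_ifs <;> norm_num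
        · have : v = u := by
            by_contra hne
            exact hv (by funext x; simp [hne])
          subst this
          exact ⟨⟨h, hu, hcr⟩, subset_rfl⟩
        · simp
      · push Not at hcr
        obtain ⟨c, hc, hlarge⟩ := hcr
        obtain ⟨q, hq0, hq1, hq2, hq3⟩ := ih c hc hlarge
        refine ⟨fun v x => q v x * ∏ c' ∈ (Φ.children u).erase c, Φ.value c' x, fun v x => ?_,
          fun v hv => ?_, fun v x y hxy => ?_, fun x => ?_⟩
        · exact mul_nonneg (hq0 v x) (Finset.prod_nonneg fun _ _ => Φ.value_nonneg _ _)
        · have hne : q v ≠ 0 := by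
            intro h0
            exact hv (by funext x; simp [h0])
          exact ⟨(hq1 v hne).1, (hq1 v hne).2.trans (Φ.scope_subset_of_mem_children hc)⟩
        -- The scope of `v` is known to lie below `c` only when `q v ≠ 0`.
        · by_cases h0 : q v = 0
          · simp [h0]
          · dsimp only
            rw [hq2 v hxy]
            congr 1
            refine Finset.prod_congr rfl fun c' hc' => ?_
            rw [Finset.mem_erase] at hc'
            refine Φ.dependsOn_value c' fun i hi => hxy i fun hiv => ?_
            exact (hD u h c' hc'.2 c hc hc'.1).notMem_of_mem_left hi ((hq1 v h0).2 hiv)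
        · rw [Φ.value_of_prod h, ← Finset.mul_prod_erase _ _ hc, hq3 x, Finset.sum_mul]
          exact Finset.sum_congr rfl fun v _ => by ring

/-- Add the items one by one. A sum below `n / 3` can jump past `2 * n / 3` only through an item of
at least `n / 3`, and that item alone is balanced. -/
theorem exists_subset_sum_balanced {α : Type} (s : Finset α) (f : α → ℕ) (n : ℕ)
    (hf : ∀ a ∈ s, 3 * f a ≤ 2 * n) (hs : n ≤ 3 * ∑ a ∈ s, f a) :
    ∃ t ⊆ s, n ≤ 3 * ∑ a ∈ t, f a ∧ 3 * ∑ a ∈ t, f a ≤ 2 * n := by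
  classical
  induction s using Finset.induction_on with
  | empty => exact ⟨∅, subset_rfl, hs, by simp⟩
  | insert a s ha ih =>
    by_cases h : n ≤ 3 * ∑ a ∈ s, f a
    · obtain ⟨t, hts, ht⟩ := ih (fun b hb => hf b (Finset.mem_insert_of_mem hb)) h
      exact ⟨t, hts.trans (Finset.subset_insert a s), ht⟩
    · by_cases h' : n ≤ 3 * f a
      · exact ⟨{a}, by simp, by simpa using h', by simpa using hf a (Finset.mem_insert_self a s)⟩
      · refine ⟨insert a s, subset_rfl, hs, ?_⟩
        rw [Finset.sum_insert ha]
        omega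

theorem ncard_biUnion_scope [Finite ι] (Φ : SPN ι) (t : Finset Φ.V)
    (ht : ∀ c₁ ∈ t, ∀ c₂ ∈ t, c₁ ≠ c₂ → Disjoint (Φ.scope c₁) (Φ.scope c₂)) :
    (⋃ c ∈ t, Φ.scope c).ncard = ∑ c ∈ t, (Φ.scope c).ncard := by
  classical
  induction t using Finset.induction_on with
  | empty => simp
  | insert a s ha ih =>
    rw [Finset.set_biUnion_insert, Finset.sum_insert ha, Set.ncard_union_eq,
      ih fun c₁ h₁ c₂ h₂ => ht c₁ (Finset.mem_insert_of_mem h₁) c₂ (Finset.mem_insert_of_mem h₂)]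
    refine Set.disjoint_iUnion₂_right.2 fun c hc => ?_
    exact ht a (Finset.mem_insert_self a s) c (Finset.mem_insert_of_mem hc)
      fun h => ha (h ▸ hc)

theorem IsCritical.exists_mul_eq [Finite ι] {Φ : SPN ι} {n : ℕ} {v : Φ.V}
    (hv : Φ.IsCritical n v) (hD : Φ.IsDecomposable) :
    ∃ (Y : Set ι) (g h : (ι → Bool) → ℝ), Y ⊆ Φ.scope v ∧ n ≤ 3 * Y.ncard ∧
      3 * Y.ncard ≤ 2 * n ∧ (∀ x, 0 ≤ g x) ∧ (∀ x, 0 ≤ h x) ∧ DependsOn g Y ∧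
      DependsOn h Yᶜ ∧ ∀ x, Φ.value v x = g x * h x := by
  classical
  have hdisj := hD v hv.label_eq
  have hsum : ∑ c ∈ Φ.children v, (Φ.scope c).ncard = (Φ.scope v).ncard := by
    rw [← Φ.ncard_biUnion_scope _ hdisj, Φ.scope_eq v, hv.label_eq]
  obtain ⟨t, hts, ht1, ht2⟩ := exists_subset_sum_balanced (Φ.children v)
    (fun c => (Φ.scope c).ncard) n hv.children_le (by have := hv.large; omega)
  have hcard := Φ.ncard_biUnion_scope t fun c₁ h₁ c₂ h₂ => hdisj c₁ (hts h₁) c₂ (hts h₂)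
  refine ⟨⋃ c ∈ t, Φ.scope c, fun x => ∏ c ∈ t, Φ.value c x,
    fun x => ∏ c ∈ Φ.children v \ t, Φ.value c x, ?_, by rwa [hcard], by rwa [hcard],
    fun x => Finset.prod_nonneg fun _ _ => Φ.value_nonneg _ _,
    fun x => Finset.prod_nonneg fun _ _ => Φ.value_nonneg _ _, fun x y hxy => ?_,
    fun x y hxy => ?_, fun x => ?_⟩
  · exact Set.iUnion₂_subset fun c hc => Φ.scope_subset_of_mem_children (hts hc)
  · exact Finset.prod_congr rfl fun c hc => Φ.dependsOn_value c fun i hi =>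
      hxy i (Set.mem_biUnion (s := (t : Set Φ.V)) hc hi)
  · refine Finset.prod_congr rfl fun c hc => Φ.dependsOn_value c fun i hi => hxy i fun hi' => ?_
    rw [Finset.mem_sdiff] at hc
    obtain ⟨c', hc', hic'⟩ := Set.mem_iUnion₂.1 hi'
    exact (hdisj c hc.1 c' (hts hc') fun h => hc.2 (h ▸ hc')).notMem_of_mem_left hi hic'
  · rw [Φ.value_of_prod hv.label_eq, mul_comm, Finset.prod_sdiff hts]

/-- A decomposable and complete network whose root has full scope computes a sum of at most `size`
products of nonnegative functions, each along a balanced partition of the variables. -/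
theorem exists_balanced_decomposition [Finite ι] (Φ : SPN ι) (hD : Φ.IsDecomposable)
    (hC : Φ.IsComplete) (hn : 2 ≤ Nat.card ι) (hroot : Φ.scope Φ.root = Set.univ) :
    ∃ (κ : Type) (_ : Fintype κ) (Y : κ → Set ι) (g h : κ → (ι → Bool) → ℝ),
      Fintype.card κ ≤ Φ.size ∧
      (∀ k, Nat.card ι ≤ 3 * (Y k).ncard ∧ 3 * (Y k).ncard ≤ 2 * Nat.card ι) ∧
      (∀ k x, 0 ≤ g k x) ∧ (∀ k x, 0 ≤ h k x) ∧ (∀ k, DependsOn (g k) (Y k)) ∧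
      (∀ k, DependsOn (h k) (Y k)ᶜ) ∧ ∀ x, Φ.output x = ∑ k, g k x * h k x := by
  classical
  have := Φ.finite_V
  have := Fintype.ofFinite Φ.V
  obtain ⟨q, hq0, hq1, hq2, hq3⟩ := Φ.exists_sum_critical hD hC hn Φ.root
    (by rw [hroot, Set.ncard_univ]; omega)
  choose Y g h hY hY1 hY2 hg hh hgY hhY hgh using
    fun v : {v // Φ.IsCritical (Nat.card ι) v} => v.2.exists_mul_eq hD
  refine ⟨{v // Φ.IsCritical (Nat.card ι) v}, inferInstance, Y, g,
    fun v x => q v x * h v x, ?_, fun v => ⟨hY1 v, hY2 v⟩, hg,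
    fun v x => mul_nonneg (hq0 _ _) (hh _ _), hgY, fun v x y hxy => ?_, fun x => ?_⟩
  · rw [← Nat.card_eq_fintype_card]
    exact Nat.card_le_card_of_injective (fun v => ⟨v.1, Or.inr v.2.label_eq⟩)
      fun v w hvw => Subtype.ext (congrArg (fun z => z.1) hvw)
  -- The coefficient lives off the scope of `v`, hence off `Y v`, and so joins the second factor.
  · dsimp only
    rw [hhY v hxy, hq2 v fun i hi => hxy i fun hi' => hi (hY v hi')]
  · change Φ.value Φ.root x = _
    rw [hq3 x]
    have h1 : ∀ v : {v // Φ.IsCritical (Nat.card ι) v},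
        g v x * (q v x * h v x) = q v x * Φ.value v x := fun v => by
      rw [hgh v x]; ring
    simp only [h1]
    rw [← Finset.sum_subtype (Finset.univ.filter (Φ.IsCritical (Nat.card ι))) (by simp)
      (fun v => q v x * Φ.value v x), Finset.sum_filter_of_ne]
    intro v _ hv
    refine (hq1 v fun h0 => hv ?_).1
    simp [h0]

end SPN

/-! ### Adjacency, triangles and crossings -/

/-- The symmetric adjacency function of the graph with edge indicators `E`. -/
def adjacent {M : ℕ} (E : EdgeVar M → Bool) (a b : Fin M) : Bool :=
  if h : a < b then E ⟨(a, b), h⟩ else if h : b < a then E ⟨(b, a), h⟩ else false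

section Graph

variable {M : ℕ}

theorem adjacent_of_lt (E : EdgeVar M → Bool) {a b : Fin M} (h : a < b) :
    adjacent E a b = E ⟨(a, b), h⟩ := by
  simp [adjacent, h]

theorem adjacent_comm (E : EdgeVar M → Bool) (a b : Fin M) : adjacent E a b = adjacent E b a := by
  rcases lt_trichotomy a b with h | h | h
  · simp [adjacent, h, h.not_gt]
  · rw [h]
  · simp [adjacent, h, h.not_gt]

theorem adjacent_self (E : EdgeVar M → Bool) (a : Fin M) : adjacent E a a = false := by
  simp [adjacent]

theorem TriangleFree.not_adjacent {E : EdgeVar M → Bool} (hE : TriangleFree E) (a b c : Fin M)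
    (hab : adjacent E a b = true) (hbc : adjacent E b c = true) (hac : adjacent E a c = true) :
    False := by
  have key : ∀ a b c : Fin M, a < b → b < c → adjacent E a b = true → adjacent E b c = true →
      adjacent E a c = true → False := by
    intro a b c h₁ h₂ hab hbc hac
    rw [adjacent_of_lt E h₁] at hab
    rw [adjacent_of_lt E h₂] at hbc
    rw [adjacent_of_lt E (h₁.trans h₂)] at hac
    have := hE a b c h₁ h₂
    simp [hab, hbc, hac] at this
  have hab' := adjacent_comm E a b ▸ hab
  have hbc' := adjacent_comm E b c ▸ hbc
  have hac' := adjacent_comm E a c ▸ hac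
  rcases lt_trichotomy a b with h₁ | rfl | h₁
  · rcases lt_trichotomy b c with h₂ | rfl | h₂
    · exact key a b c h₁ h₂ hab hbc hac
    · simp [adjacent_self] at hbc
    · rcases lt_trichotomy a c with h₃ | rfl | h₃
      · exact key a c b h₃ h₂ hac hbc' hab
      · simp [adjacent_self] at hac
      · exact key c a b h₃ h₁ hac' hab hbc'
  · simp [adjacent_self] at hab
  · rcases lt_trichotomy b c with h₂ | rfl | h₂
    · rcases lt_trichotomy a c with h₃ | rfl | h₃
      · exact key b a c h₁ h₃ hab' hac hbc
      · simp [adjacent_self] at hac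
      · exact key b c a h₂ h₃ hbc hac' hab'
    · simp [adjacent_self] at hbc
    · exact key c b a h₂ h₁ hbc' hab' hac'

theorem triangleFree_of_adjacent {E : EdgeVar M → Bool}
    (h : ∀ a b c : Fin M, adjacent E a b = true → adjacent E b c = true →
      adjacent E a c = true → False) : TriangleFree E := by
  intro a b c h₁ h₂
  have := h a b c
  rw [adjacent_of_lt E h₁, adjacent_of_lt E h₂, adjacent_of_lt E (h₁.trans h₂)] at this
  by_contra hcon
  simp only [not_or, Bool.not_eq_false] at hcon
  exact this hcon.1 hcon.2.1 hcon.2.2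

/-- The edge variables that agree with `E` where `y` is true and with `E'` elsewhere. -/
def crossing {ι : Type} (y E E' : ι → Bool) (e : ι) : Bool := if y e then E e else E' e

theorem adjacent_crossing (y E E' : EdgeVar M → Bool) (a b : Fin M) :
    adjacent (crossing y E E') a b =
      if adjacent y a b then adjacent E a b else adjacent E' a b := by
  rcases lt_trichotomy a b with h | rfl | h
  · simp [adjacent, crossing, h]
  · simp [adjacent_self]
  · simp [adjacent, crossing, h, h.not_gt]


theorem adjacent_decide (p : Fin M → Fin M → Prop) [∀ a b, Decidable (p a b)]
    (hsymm : ∀ a b, p a b → p b a) (hirrefl : ∀ a, ¬ p a a) (a b : Fin M) :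
    adjacent (fun e => decide (p e.1.1 e.1.2)) a b = true ↔ p a b := by
  rcases lt_trichotomy a b with h | rfl | h
  · simp [adjacent, h]
  · simp [adjacent_self, hirrefl]
  · simp only [adjacent, h, h.not_gt, dite_true, dite_false, decide_eq_true_eq]
    exact ⟨hsymm b a, hsymm a b⟩

/-! ### Disjoint paths of length two -/

/-- The disjoint union of the paths of length two on the triples `t j`, with midpoints
`t j (r j)`. -/
def cherries {m : ℕ} (t : Fin m → Fin 3 → Fin M) (r : Fin m → Fin 3) (e : EdgeVar M) : Bool :=
  decide (∃ j k, k ≠ r j ∧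
    (e.1.1 = t j (r j) ∧ e.1.2 = t j k ∨ e.1.2 = t j (r j) ∧ e.1.1 = t j k))

variable {m : ℕ} {t : Fin m → Fin 3 → Fin M}

theorem adjacent_cherries (ht : Function.Injective2 t) (r : Fin m → Fin 3) (a b : Fin M) :
    adjacent (cherries t r) a b = true ↔ ∃ j k, k ≠ r j ∧
      (a = t j (r j) ∧ b = t j k ∨ b = t j (r j) ∧ a = t j k) := by
  refine adjacent_decide (fun a b => ∃ j k, k ≠ r j ∧
      (a = t j (r j) ∧ b = t j k ∨ b = t j (r j) ∧ a = t j k)) ?_ ?_ a b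
  · rintro a b ⟨j, k, hk, h⟩
    exact ⟨j, k, hk, h.symm⟩
  · rintro a ⟨j, k, hk, ⟨h₁, h₂⟩ | ⟨h₁, h₂⟩⟩ <;> exact hk (ht (h₂.symm.trans h₁)).2

theorem adjacent_cherries_of_ne (ht : Function.Injective2 t) (r : Fin m → Fin 3) (j : Fin m)
    {k l : Fin 3} (hkl : k ≠ l) (h : r j = k ∨ r j = l) :
    adjacent (cherries t r) (t j k) (t j l) = true := by
  rw [adjacent_cherries ht]
  rcases h with rfl | rfl
  · exact ⟨j, l, hkl.symm, Or.inl ⟨rfl, rfl⟩⟩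
  · exact ⟨j, k, hkl, Or.inr ⟨rfl, rfl⟩⟩

/-- The graph is bipartite: every edge joins a midpoint to a non-midpoint. -/
theorem triangleFree_cherries (ht : Function.Injective2 t) (r : Fin m → Fin 3) :
    TriangleFree (cherries t r) := by
  have key : ∀ a b : Fin M, adjacent (cherries t r) a b = true →
      ((∃ j, a = t j (r j)) ↔ ¬ ∃ j, b = t j (r j)) := by
    intro a b hab
    obtain ⟨j, k, hk, h⟩ := (adjacent_cherries ht r a b).1 hab
    have hleaf : ¬ ∃ i, t j k = t i (r i) := by
      rintro ⟨i, hi⟩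
      obtain ⟨rfl, hki⟩ := ht hi
      exact hk hki
    rcases h with ⟨rfl, rfl⟩ | ⟨rfl, rfl⟩
    · exact ⟨fun _ => hleaf, fun _ => ⟨j, rfl⟩⟩
    · exact ⟨fun h => absurd h hleaf, fun h => absurd ⟨j, rfl⟩ h⟩
  refine triangleFree_of_adjacent fun a b c hab hbc hac => ?_
  have h₁ := key a b hab
  have h₂ := key b c hbc
  have h₃ := key a c hac
  tauto

/-- With the edges coloured by `y`, the edge of the triangle `a` opposite to `a k` has a colour
different from that of both other edges. -/
def OppositeEdgeLonely (y : EdgeVar M → Bool) (a : Fin 3 → Fin M) (k : Fin 3) : Prop :=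
  adjacent y (a k) (a (k + 1)) ≠ adjacent y (a (k + 1)) (a (k + 2)) ∧
    adjacent y (a k) (a (k + 2)) ≠ adjacent y (a (k + 1)) (a (k + 2))

/-- With another midpoint, `r'` supplies the edge opposite to `k` while `r` supplies the other two,
and a crossing closes the triangle. Which crossing does so depends on the colour of the lonely edge,
so both are assumed triangle-free. -/
theorem midpoint_eq_of_crossing (ht : Function.Injective2 t) {y : EdgeVar M → Bool}
    {r r' : Fin m → Fin 3} (h₁ : TriangleFree (crossing y (cherries t r) (cherries t r')))
    (h₂ : TriangleFree (crossing y (cherries t r') (cherries t r))) {j : Fin m} {k : Fin 3}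
    (hk : OppositeEdgeLonely y (t j) k) (hr : r j = k) : r' j = k := by
  by_contra hr'
  have k₁ : k ≠ k + 1 := (by decide : ∀ k : Fin 3, k ≠ k + 1) k
  have k₂ : k ≠ k + 2 := (by decide : ∀ k : Fin 3, k ≠ k + 2) k
  have k₃ : k + 1 ≠ k + 2 := (by decide : ∀ k : Fin 3, k + 1 ≠ k + 2) k
  have k₄ : r' j = k + 1 ∨ r' j = k + 2 := by
    generalize r' j = l at hr'
    clear * - hr'
    revert k l
    decide
  have e₁ := adjacent_cherries_of_ne ht r j k₁ (Or.inl hr)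
  have e₂ := adjacent_cherries_of_ne ht r j k₂ (Or.inl hr)
  have e₃ := adjacent_cherries_of_ne ht r' j k₃ k₄
  obtain ⟨hc₁, hc₂⟩ := hk
  cases hc : adjacent y (t j (k + 1)) (t j (k + 2)) with
  | true =>
    simp only [hc, ne_eq, Bool.not_eq_true] at hc₁ hc₂
    refine h₂.not_adjacent (t j k) (t j (k + 1)) (t j (k + 2)) ?_ ?_ ?_ <;>
      simpa [adjacent_crossing, hc, hc₁, hc₂]
  | false =>
    simp only [hc, ne_eq, Bool.not_eq_false] at hc₁ hc₂
    refine h₁.not_adjacent (t j k) (t j (k + 1)) (t j (k + 2)) ?_ ?_ ?_ <;>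
      simpa [adjacent_crossing, hc, hc₁, hc₂]

open Classical in
/-- The number of midpoints of the triple `a` available to a family of graphs that is closed under
crossing along `y`. -/
noncomputable def midpointBound (y : EdgeVar M → Bool) (a : Fin 3 → Fin M) : ℕ :=
  if ∃ k, OppositeEdgeLonely y a k then 2 else 3

-- One member `r₀` decides, at each triple, whether the midpoint is the vertex `k` opposite to a
-- lonely edge. All members agree with it, which leaves one or two choices there.
open Classical in
theorem card_midpoints_le (ht : Function.Injective2 t) {y : EdgeVar M → Bool}
    {S : Set (EdgeVar M → Bool)} (hS : ∀ E ∈ S, ∀ E' ∈ S, TriangleFree (crossing y E E')) :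
    (Finset.univ.filter fun r => cherries t r ∈ S).card ≤ ∏ j, midpointBound y (t j) := by
  rcases (Finset.univ.filter fun r => cherries t r ∈ S).eq_empty_or_nonempty with h0 | ⟨r₀, h0⟩
  · simp [h0]
  replace h0 := (Finset.mem_filter.1 h0).2
  let A : Fin m → Finset (Fin 3) := fun j =>
    Finset.univ.filter fun x => ∀ k, OppositeEdgeLonely y (t j) k → (x = k ↔ r₀ j = k)
  have hsub : (Finset.univ.filter fun r => cherries t r ∈ S) ⊆ Fintype.piFinset A := by
    intro r hr
    replace hr := (Finset.mem_filter.1 hr).2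
    refine Fintype.mem_piFinset.2 fun j => Finset.mem_filter.2 ⟨Finset.mem_univ _, fun k hk => ?_⟩
    exact ⟨midpoint_eq_of_crossing ht (hS _ hr _ h0) (hS _ h0 _ hr) hk,
      midpoint_eq_of_crossing ht (hS _ h0 _ hr) (hS _ hr _ h0) hk⟩
  refine (Finset.card_le_card hsub).trans ?_
  rw [Fintype.card_piFinset]
  refine Finset.prod_le_prod' fun j _ => ?_
  rw [midpointBound]
  split_ifs with h
  · obtain ⟨k, hk⟩ := h
    have : A j ⊆ Finset.univ.filter fun x => (x = k ↔ r₀ j = k) := fun x hx =>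
      Finset.mem_filter.2 ⟨Finset.mem_univ _, (Finset.mem_filter.1 hx).2 k hk⟩
    refine (Finset.card_le_card this).trans ?_
    generalize r₀ j = l
    by_cases hl : l = k
    · simp [hl, Finset.filter_eq']
    · have : (Finset.univ.filter fun x => (x = k ↔ l = k)) = ({k} : Finset (Fin 3))ᶜ := by
        ext x; simp [hl]
      rw [this, Finset.card_compl]
      simp
  · exact (Finset.card_le_univ _).trans (by simp)

end Graph

/-! ### Choosing disjoint triples -/

section Greedy

variable {M : ℕ}

/-- The injective triples of vertices outside `U`. -/
def triplesAvoiding (U : Finset (Fin M)) : Finset (Fin 3 → Fin M) :=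
  Finset.univ.filter fun a => Function.Injective a ∧ ∀ k, a k ∉ U

theorem mem_triplesAvoiding {U : Finset (Fin M)} {a : Fin 3 → Fin M} :
    a ∈ triplesAvoiding U ↔ Function.Injective a ∧ ∀ k, a k ∉ U := by
  simp [triplesAvoiding]

/-- The method of conditional expectations: if the weights of a random triple average to at most
`ρ`, then some disjoint triples have small product weights simultaneously. -/
theorem exists_disjoint_triples {κ : Type} [Fintype κ] (w : κ → (Fin 3 → Fin M) → ℝ) {ρ : ℝ}
    (hρ : 0 ≤ ρ) (hw : ∀ i a, 0 ≤ w i a) {L : ℕ}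
    (hne : ∀ U : Finset (Fin M), U.card ≤ L → (triplesAvoiding U).Nonempty)
    (hsum : ∀ U : Finset (Fin M), U.card ≤ L → ∀ i,
      ∑ a ∈ triplesAvoiding U, w i a ≤ (triplesAvoiding U).card * ρ)
    (m : ℕ) (U : Finset (Fin M)) (hU : U.card + 3 * m ≤ L) (W : κ → ℝ) (hW : ∀ i, 0 ≤ W i) :
    ∃ t : Fin m → Fin 3 → Fin M, Function.Injective2 t ∧ (∀ j k, t j k ∉ U) ∧
      ∑ i, W i * ∏ j, w i (t j) ≤ ρ ^ m * ∑ i, W i := by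
  induction m generalizing U W with
  | zero => exact ⟨fun j => j.elim0, fun j => j.elim0, fun j => j.elim0, by simp⟩
  | succ m ih =>
    have hUL : U.card ≤ L := by omega
    have havg : ∑ a ∈ triplesAvoiding U, ∑ i, W i * w i a ≤
        ∑ _a ∈ triplesAvoiding U, ρ * ∑ i, W i := by
      rw [Finset.sum_comm, Finset.sum_const, nsmul_eq_mul, ← mul_assoc, Finset.mul_sum]
      refine Finset.sum_le_sum fun i _ => ?_
      rw [← Finset.mul_sum, mul_comm]
      exact mul_le_mul_of_nonneg_right (hsum U hUL i) (hW i)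
    obtain ⟨a, ha, hle⟩ := Finset.exists_le_of_sum_le (hne U hUL) havg
    rw [mem_triplesAvoiding] at ha
    have hcard : (U ∪ Finset.univ.image a).card + 3 * m ≤ L := by
      have h₁ := Finset.card_union_le U (Finset.univ.image a)
      have h₂ : (Finset.univ.image a).card ≤ 3 := Finset.card_image_le.trans (by simp)
      omega
    -- The chosen triple is absorbed into the weights, which is why `W` is arbitrary.
    obtain ⟨t, ht, htU, htle⟩ := ih _ hcard (fun i => W i * w i a)
      fun i => mul_nonneg (hW i) (hw i a)
    have hta : ∀ j k l, t j k ≠ a l := fun j k l h =>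
      htU j k (Finset.mem_union_right _ (h ▸ Finset.mem_image_of_mem a (Finset.mem_univ l)))
    refine ⟨Fin.cons a t, ?_, ?_, ?_⟩
    · intro j j' k k' h
      induction j using Fin.cases with
      | zero =>
        induction j' using Fin.cases with
        | zero => exact ⟨rfl, ha.1 (by simpa using h)⟩
        | succ j' => exact absurd (by simpa using h.symm) (hta j' k' k)
      | succ j =>
        induction j' using Fin.cases with
        | zero => exact absurd (by simpa using h) (hta j k k')
        | succ j' =>
          have := ht (by simpa using h)
          exact ⟨by rw [this.1], this.2⟩
    · intro j k
      induction j using Fin.cases with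
      | zero => simpa using ha.2 k
      | succ j => simpa using fun h => htU j k (Finset.mem_union_left _ h)
    · calc ∑ i, W i * ∏ j, w i (Fin.cons (α := fun _ => Fin 3 → Fin M) a t j)
          = ∑ i, W i * w i a * ∏ j, w i (t j) := by
            refine Finset.sum_congr rfl fun i _ => ?_
            rw [Fin.prod_univ_succ]
            simp [mul_assoc]
        _ ≤ ρ ^ m * ∑ i, W i * w i a := htle
        _ ≤ ρ ^ m * (ρ * ∑ i, W i) := mul_le_mul_of_nonneg_left hle (pow_nonneg hρ m)
        _ = ρ ^ (m + 1) * ∑ i, W i := by ring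

end Greedy

/-! ### Counting bichromatic triples and bounding covers -/

section Count

variable {M : ℕ}

theorem two_mul_card_edgeVar_add (M : ℕ) : 2 * Fintype.card (EdgeVar M) + M = M * M := by
  have h₁ : Fintype.card (EdgeVar M) =
      (Finset.univ.filter fun p : Fin M × Fin M => p.1 < p.2).card := Fintype.card_subtype _
  have h₂ : (Finset.univ.filter fun p : Fin M × Fin M => p.2 < p.1).card =
      (Finset.univ.filter fun p : Fin M × Fin M => p.1 < p.2).card :=
    Finset.card_bij (fun p _ => p.swap) (by simp) (by simp) fun p hp => ⟨p.swap, by simpa using hp⟩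
  have h₃ : (Finset.univ.filter fun p : Fin M × Fin M => p.1 = p.2).card = M := by
    have : (Finset.univ.filter fun p : Fin M × Fin M => p.1 = p.2) =
        Finset.univ.image fun a : Fin M => (a, a) := by
      ext ⟨a, b⟩; simp [eq_comm]
    rw [this, Finset.card_image_of_injective _ fun a b h => (Prod.ext_iff.1 h).1]
    simp
  have h₄ : (Finset.univ.filter fun p : Fin M × Fin M => p.1 < p.2).card +
      ((Finset.univ.filter fun p : Fin M × Fin M => p.2 < p.1).card +
      (Finset.univ.filter fun p : Fin M × Fin M => p.1 = p.2).card) = M * M := by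
    rw [← Finset.card_union_of_disjoint, ← Finset.card_union_of_disjoint, ← Finset.filter_or,
      ← Finset.filter_or, Finset.filter_true_of_mem]
    · simp
    · rintro ⟨a, b⟩ -
      rcases lt_trichotomy a b with h | h | h <;> simp [h]
    · refine Finset.disjoint_left.2 ?_
      rintro ⟨a, b⟩ h h'
      simp only [Finset.mem_union, Finset.mem_filter, Finset.mem_univ, true_and] at h h'
      omega
    · refine Finset.disjoint_left.2 ?_
      rintro ⟨a, b⟩ h h'
      simp only [Finset.mem_filter, Finset.mem_univ, true_and] at h h'
      omega
  omega

theorem card_le_card_adjacent (y : EdgeVar M → Bool) (b : Bool) :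
    (Finset.univ.filter fun e => y e = b).card ≤
      (Finset.univ.filter fun p : Fin M × Fin M => adjacent y p.1 p.2 = b).card := by
  refine Finset.card_le_card_of_injOn Subtype.val (fun e he => ?_)
    Subtype.val_injective.injOn
  simpa [adjacent_of_lt y e.2] using he

/-- The triples at whose middle vertex two differently coloured pairs meet. -/
def bichromaticTriples (χ : Fin M → Fin M → Bool) : Finset (Fin M × Fin M × Fin M) :=
  Finset.univ.filter fun p => χ p.1 p.2.1 ≠ χ p.2.1 p.2.2

/-- Write a `true` pair `(a, b)` before a `false` pair `(c, d)`. The colour of `(b, c)` decides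
whether the change occurs at `b` or at `c`; the remaining end vertex is free, whence the factor `2 *
M`. -/
theorem card_mul_card_le_bichromaticTriples (χ : Fin M → Fin M → Bool) :
    (Finset.univ.filter fun p : Fin M × Fin M => χ p.1 p.2 = true).card *
      (Finset.univ.filter fun p : Fin M × Fin M => χ p.1 p.2 = false).card ≤
      2 * M * (bichromaticTriples χ).card := by
  set R := Finset.univ.filter fun p : Fin M × Fin M => χ p.1 p.2 = true
  set R' := Finset.univ.filter fun p : Fin M × Fin M => χ p.1 p.2 = false
  have hsub : R ×ˢ R' ⊆
      ((bichromaticTriples χ ×ˢ Finset.univ).image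
        fun p : (Fin M × Fin M × Fin M) × Fin M => ((p.1.1, p.1.2.1), (p.1.2.2, p.2))) ∪
      ((bichromaticTriples χ ×ˢ Finset.univ).image
        fun p : (Fin M × Fin M × Fin M) × Fin M => ((p.2, p.1.1), (p.1.2.1, p.1.2.2))) := by
    rintro ⟨⟨a, b⟩, ⟨c, d⟩⟩ h
    simp only [R, R', Finset.mem_product, Finset.mem_filter, Finset.mem_univ, true_and] at h
    rw [Finset.mem_union]
    by_cases hbc : χ b c = true
    · refine Or.inr (Finset.mem_image.2 ⟨((b, c, d), a), ?_, rfl⟩)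
      simp [bichromaticTriples, hbc, h.2]
    · refine Or.inl (Finset.mem_image.2 ⟨((a, b, c), d), ?_, rfl⟩)
      simp [bichromaticTriples, hbc, h.1]
  rw [← Finset.card_product]
  refine (Finset.card_le_card hsub).trans ((Finset.card_union_le _ _).trans ?_)
  refine (Nat.add_le_add Finset.card_image_le Finset.card_image_le).trans ?_
  rw [Finset.card_product, Finset.card_univ, Fintype.card_fin]
  apply le_of_eq
  ring

theorem card_bichromaticTriples_ge {y : EdgeVar M → Bool} (hM : 4 ≤ M)
    (hy : ∀ b, Fintype.card (EdgeVar M) ≤ 3 * (Finset.univ.filter fun e => y e = b).card) :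
    7 * M ^ 3 ≤ 128 * (bichromaticTriples (adjacent y)).card := by
  have h₁ := card_mul_card_le_bichromaticTriples (adjacent y)
  have h₂ := two_mul_card_edgeVar_add M
  have h₃ := (hy true).trans (Nat.mul_le_mul_left 3 (card_le_card_adjacent y true))
  have h₄ := (hy false).trans (Nat.mul_le_mul_left 3 (card_le_card_adjacent y false))
  have h₅ : (Finset.univ.filter fun p : Fin M × Fin M => adjacent y p.1 p.2 = true).card +
      (Finset.univ.filter fun p : Fin M × Fin M => adjacent y p.1 p.2 = false).card = M * M := by
    have := Finset.card_filter_add_card_filter_not (s := (Finset.univ : Finset (Fin M × Fin M)))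
      (fun p => adjacent y p.1 p.2 = true)
    simpa using this
  set R := (Finset.univ.filter fun p : Fin M × Fin M => adjacent y p.1 p.2 = true).card
  set R' := (Finset.univ.filter fun p : Fin M × Fin M => adjacent y p.1 p.2 = false).card
  set B := (bichromaticTriples (adjacent y)).card
  -- `M * M - M ≤ 6 * R`, and `4 ≤ M` absorbs the linear term.
  have h₆ : M * M ≤ 8 * R := by nlinarith
  have h₇ : M * M ≤ 8 * R' := by nlinarith
  -- For a fixed sum the product is least at the extreme split 1/8, 7/8.
  have h₈ : 7 * (M * M) ^ 2 ≤ 64 * (R * R') := by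
    zify at h₅ h₆ h₇ ⊢
    nlinarith [mul_nonneg (sub_nonneg.2 h₆) (sub_nonneg.2 h₇)]
  have h₉ : M * (7 * M ^ 3) ≤ M * (128 * B) := by nlinarith
  exact Nat.le_of_mul_le_mul_left h₉ (by omega)

/-- The third edge shares its colour with one of the two given edges; the other one is lonely. -/
theorem exists_oppositeEdgeLonely (y : EdgeVar M → Bool) {a b c : Fin M}
    (h : adjacent y a b ≠ adjacent y b c) : ∃ k, OppositeEdgeLonely y ![a, b, c] k := by
  have h₁ := adjacent_comm y a b
  have h₂ := adjacent_comm y b c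
  have h₃ := adjacent_comm y a c
  by_cases hac : adjacent y a c = adjacent y a b
  · refine ⟨0, ?_⟩
    simp [OppositeEdgeLonely, hac, h]
  · refine ⟨2, ?_⟩
    have hac' : adjacent y a c = adjacent y b c := by
      revert h hac
      cases adjacent y a b <;> cases adjacent y b c <;> cases adjacent y a c <;> decide
    have e₁ : (2 + 1 : Fin 3) = 0 := rfl
    have e₂ : (2 + 2 : Fin 3) = 1 := rfl
    simp only [OppositeEdgeLonely, e₁, e₂, Matrix.cons_val]
    rw [← h₂, ← h₃, hac']
    exact ⟨h.symm, h.symm⟩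

-- Of at least `7/128 * M ^ 3` bichromatic triples, those with `a = b`, with `b = c`, or with a
-- given entry in `U` are discarded: five classes of at most `M ^ 3 / 400` each, and `7/128 - 5/400
-- ≥ 1/32`. The case `a = c` is excluded by symmetry of the colouring.
open Classical in
theorem card_triplesAvoiding_lonely_ge {y : EdgeVar M → Bool} (hM : 400 ≤ M)
    (hy : ∀ b, Fintype.card (EdgeVar M) ≤ 3 * (Finset.univ.filter fun e => y e = b).card)
    {U : Finset (Fin M)} (hU : 400 * U.card ≤ M) :
    M ^ 3 ≤ 32 * ((triplesAvoiding U).filter fun a => ∃ k, OppositeEdgeLonely y a k).card := by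
  have h₁ := card_bichromaticTriples_ge (by omega) hy
  set T := (triplesAvoiding U).filter fun a => ∃ k, OppositeEdgeLonely y a k with hT
  have hsub : bichromaticTriples (adjacent y) ⊆ T.image (fun a => (a 0, a 1, a 2)) ∪
      ((Finset.univ.image fun p : Fin M × Fin M => (p.1, p.1, p.2)) ∪
      ((Finset.univ.image fun p : Fin M × Fin M => (p.1, p.2, p.2)) ∪
      ((U ×ˢ (Finset.univ ×ˢ Finset.univ)) ∪ ((Finset.univ ×ˢ (U ×ˢ Finset.univ)) ∪
      (Finset.univ ×ˢ (Finset.univ ×ˢ U)))))) := by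
    rintro ⟨a, b, c⟩ h
    simp only [bichromaticTriples, Finset.mem_filter, Finset.mem_univ, true_and] at h
    by_contra hcon
    simp only [Finset.mem_union, Finset.mem_product, Finset.mem_univ, true_and, and_true,
      not_or] at hcon
    obtain ⟨hT', hab, hbc, haU, hbU, hcU⟩ := hcon
    have hab' : a ≠ b := fun h' => hab (Finset.mem_image.2 ⟨(a, c), Finset.mem_univ _, by simp [h']⟩)
    have hbc' : b ≠ c := fun h' => hbc (Finset.mem_image.2 ⟨(a, b), Finset.mem_univ _, by simp [h']⟩)
    have hac' : a ≠ c := by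
      rintro rfl
      exact h (adjacent_comm y a b)
    refine hT' (Finset.mem_image.2 ⟨![a, b, c], Finset.mem_filter.2 ⟨?_, ?_⟩, by simp⟩)
    · rw [mem_triplesAvoiding]
      constructor
      · intro i j hij
        fin_cases i <;> fin_cases j <;> simp_all
      · intro k
        fin_cases k <;> simpa
    · exact exists_oppositeEdgeLonely y h
  have hcard : (bichromaticTriples (adjacent y)).card ≤
      T.card + (M * M + (M * M + (U.card * (M * M) + (M * (U.card * M) + M * (M * U.card))))) := by
    refine (Finset.card_le_card hsub).trans ((Finset.card_union_le _ _).trans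
      (Nat.add_le_add Finset.card_image_le ?_))
    refine (Finset.card_union_le _ _).trans (Nat.add_le_add ?_ ?_)
    · exact Finset.card_image_le.trans (by simp)
    refine (Finset.card_union_le _ _).trans (Nat.add_le_add ?_ ?_)
    · exact Finset.card_image_le.trans (by simp)
    refine (Finset.card_union_le _ _).trans (Nat.add_le_add (by simp) ?_)
    exact (Finset.card_union_le _ _).trans (Nat.add_le_add (by simp) (by simp))
  have h₂ : 400 * (M * M) ≤ M ^ 3 := by
    rw [pow_succ', pow_two]
    exact Nat.mul_le_mul_right _ hM
  have h₃ : 400 * (U.card * (M * M)) ≤ M ^ 3 := by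
    rw [pow_succ', pow_two, ← mul_assoc]
    exact Nat.mul_le_mul_right _ hU
  have h₄ : M * (U.card * M) = U.card * (M * M) := by ring
  have h₅ : M * (M * U.card) = U.card * (M * M) := by ring
  rw [h₄, h₅] at hcard
  omega

theorem card_triplesAvoiding_le (U : Finset (Fin M)) : (triplesAvoiding U).card ≤ M ^ 3 :=
  (Finset.card_le_univ _).trans (by simp)

/-- At least a fraction 1/32 of the triples loses one of three options, and `95/32 = 3 - 1/32`. -/
theorem sum_midpointBound_le {y : EdgeVar M → Bool} (hM : 400 ≤ M)
    (hy : ∀ b, Fintype.card (EdgeVar M) ≤ 3 * (Finset.univ.filter fun e => y e = b).card)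
    {U : Finset (Fin M)} (hU : 400 * U.card ≤ M) :
    ∑ a ∈ triplesAvoiding U, (midpointBound y a : ℝ) ≤ (triplesAvoiding U).card * (95 / 32) := by
  classical
  have h₁ := card_triplesAvoiding_lonely_ge hM hy hU
  have h₂ := card_triplesAvoiding_le U
  have h₃ : ∑ a ∈ triplesAvoiding U, (midpointBound y a : ℝ) =
      3 * (triplesAvoiding U).card -
        ((triplesAvoiding U).filter fun a => ∃ k, OppositeEdgeLonely y a k).card := by
    have : ∀ a, (midpointBound y a : ℝ) =
        3 - if ∃ k, OppositeEdgeLonely y a k then (1 : ℝ) else 0 := fun a => by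
      rw [midpointBound]
      split_ifs <;> norm_num
    simp only [this, Finset.sum_sub_distrib, Finset.sum_boole, Finset.sum_const, nsmul_eq_mul]
    ring
  have h₄ : ((triplesAvoiding U).card : ℝ) ≤
      32 * ((triplesAvoiding U).filter fun a => ∃ k, OppositeEdgeLonely y a k).card := by
    exact_mod_cast h₂.trans h₁
  rw [h₃]
  linarith

/-- A cover of the triangle-free graphs by sets that are closed under crossing along balanced
partitions of the edges is exponentially large. -/
theorem pow_le_card_of_crossing_cover {κ : Type} [Fintype κ] (hM : 400 ≤ M)
    (y : κ → EdgeVar M → Bool)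
    (hy : ∀ i b, Fintype.card (EdgeVar M) ≤ 3 * (Finset.univ.filter fun e => y i e = b).card)
    (S : κ → Set (EdgeVar M → Bool))
    (hS : ∀ i, ∀ E ∈ S i, ∀ E' ∈ S i, TriangleFree (crossing (y i) E E'))
    (hcover : ∀ E, TriangleFree E → ∃ i, E ∈ S i) {m : ℕ} (hm : 1200 * m ≤ M) :
    (96 / 95 : ℝ) ^ m ≤ Fintype.card κ := by
  classical
  have hne : ∀ U : Finset (Fin M), U.card ≤ M / 400 → (triplesAvoiding U).Nonempty := by
    intro U hU
    -- The lower bound on triples needs some balanced colouring; covering the empty graph provides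
    -- an index.
    obtain ⟨i, -⟩ := hcover _ (triangleFree_cherries
      (t := fun j : Fin 0 => j.elim0) (fun j => j.elim0) fun _ => 0)
    have := card_triplesAvoiding_lonely_ge hM (hy i) (U := U) (by omega)
    have hpos : 0 < M ^ 3 := by positivity
    by_contra hcon
    rw [Finset.not_nonempty_iff_eq_empty] at hcon
    simp [hcon] at this
    omega
  obtain ⟨t, ht, -, hle⟩ := exists_disjoint_triples (fun i a => (midpointBound (y i) a : ℝ))
    (ρ := 95 / 32) (by norm_num) (fun _ _ => Nat.cast_nonneg _) hne
    (fun U hU i => sum_midpointBound_le hM (hy i) (by omega)) m ∅ (by simp; omega)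
    (fun _ => 1) fun _ => zero_le_one
  have hcount : 3 ^ m ≤ ∑ i, ∏ j, midpointBound (y i) (t j) := by
    calc 3 ^ m = (Finset.univ : Finset (Fin m → Fin 3)).card := by simp
      _ ≤ (Finset.univ.biUnion fun i => Finset.univ.filter fun r => cherries t r ∈ S i).card := by
        refine Finset.card_le_card fun r _ => ?_
        obtain ⟨i, hi⟩ := hcover _ (triangleFree_cherries ht r)
        simpa using ⟨i, hi⟩
      _ ≤ ∑ i, (Finset.univ.filter fun r => cherries t r ∈ S i).card := Finset.card_biUnion_le
      _ ≤ _ := Finset.sum_le_sum fun i _ => card_midpoints_le ht (hS i)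
  have hcount' : (3 : ℝ) ^ m ≤ (95 / 32) ^ m * Fintype.card κ := by
    have h : (3 : ℝ) ^ m ≤ ∑ i, ∏ j, (midpointBound (y i) (t j) : ℝ) := by exact_mod_cast hcount
    exact h.trans (by simpa using hle)
  have hsplit : (3 : ℝ) ^ m = (95 / 32) ^ m * (96 / 95) ^ m := by
    rw [← mul_pow]; norm_num
  rw [hsplit] at hcount'
  exact le_of_mul_le_mul_left hcount' (by positivity)

end Count

/-! ### From approximating networks to crossing covers -/

section Approximation

variable {M : ℕ}

/-- A path joining the ends of `e` through a third vertex lacks only `e` to be a triangle. This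
forces every edge variable into the scope of the root. -/
theorem exists_triangleFree_update_not_triangleFree (hM : 3 ≤ M) (e : EdgeVar M) :
    ∃ E : EdgeVar M → Bool, TriangleFree E ∧ ¬ TriangleFree (Function.update E e true) := by
  obtain ⟨⟨a, b⟩, hab⟩ := e
  replace hab : a < b := hab
  obtain ⟨c, hc⟩ : ∃ c, c ∉ ({a, b} : Finset (Fin M)) := by
    by_contra! h
    have h₁ := Finset.card_le_card (fun c _ => h c : (Finset.univ : Finset (Fin M)) ⊆ {a, b})
    have h₂ := Finset.card_le_two (a := a) (b := b)
    simp only [Finset.card_univ, Fintype.card_fin] at h₁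
    omega
  simp only [Finset.mem_insert, Finset.mem_singleton, not_or] at hc
  have ht : Function.Injective2 (fun _ : Fin 1 => ![a, b, c]) := by
    intro j j' k k' h
    refine ⟨Subsingleton.elim _ _, ?_⟩
    have := hab.ne
    fin_cases k <;> fin_cases k' <;> simp_all
  set E := cherries (fun _ : Fin 1 => ![a, b, c]) fun _ => 2 with hE
  have hmono : ∀ x y, adjacent E x y = true →
      adjacent (Function.update E ⟨(a, b), hab⟩ true) x y = true := by
    intro x y
    have : ∀ f, E f = true → Function.update E ⟨(a, b), hab⟩ true f = true := by
      intro f hf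
      by_cases h : f = ⟨(a, b), hab⟩ <;> simp [h, hf]
    simp only [adjacent]
    split_ifs
    · exact this _
    · exact this _
    · exact id
  refine ⟨E, triangleFree_cherries ht _, fun hcon => hcon.not_adjacent a b c ?_ ?_ ?_⟩
  · simp [adjacent_of_lt _ hab]
  · exact hmono _ _ (adjacent_cherries_of_ne ht _ 0 (k := 1) (l := 2) (by decide) (Or.inr rfl))
  · exact hmono _ _ (adjacent_cherries_of_ne ht _ 0 (k := 0) (l := 2) (by decide) (Or.inr rfl))

theorem IsStrictlyPositiveTriangleFreeDist.exists_le {d : (EdgeVar M → Bool) → ℝ}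
    (hd : IsStrictlyPositiveTriangleFreeDist d) :
    ∃ δ, 0 < δ ∧ ∀ E, TriangleFree E → δ ≤ d E := by
  have : Nonempty {E : EdgeVar M → Bool // TriangleFree E} :=
    ⟨⟨fun _ => false, fun _ _ _ _ _ => Or.inl rfl⟩⟩
  obtain ⟨E₀, hE₀⟩ := Finite.exists_min fun E : {E : EdgeVar M → Bool // TriangleFree E} => d E
  exact ⟨d E₀, (hd.pos_iff _).2 E₀.2, fun E hE => hE₀ ⟨E, hE⟩⟩

theorem IsStrictlyPositiveTriangleFreeDist.le_one {d : (EdgeVar M → Bool) → ℝ}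
    (hd : IsStrictlyPositiveTriangleFreeDist d) (E : EdgeVar M → Bool) : d E ≤ 1 := by
  rw [← hd.sum_eq_one]
  exact Finset.single_le_sum (fun E _ => hd.nonneg E) (Finset.mem_univ E)

theorem IsStrictlyPositiveTriangleFreeDist.eq_zero {d : (EdgeVar M → Bool) → ℝ}
    (hd : IsStrictlyPositiveTriangleFreeDist d) {E : EdgeVar M → Bool} (hE : ¬ TriangleFree E) :
    d E = 0 :=
  le_antisymm (not_lt.1 fun h => hE ((hd.pos_iff E).1 h)) (hd.nonneg E)

/-- An approximable strictly positive distribution yields a cover of the triangle-free graphs by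
sets that are closed under crossing along balanced partitions of the edges. -/
theorem exists_crossing_cover (hM : 3 ≤ M) {d : (EdgeVar M → Bool) → ℝ}
    (hd : IsStrictlyPositiveTriangleFreeDist d) {s : ℕ} (hs : ApproximableBySPN d s) :
    ∃ (κ : Type) (_ : Fintype κ) (y : κ → EdgeVar M → Bool) (S : κ → Set (EdgeVar M → Bool)),
      Fintype.card κ ≤ s ∧
      (∀ i b, Fintype.card (EdgeVar M) ≤ 3 * (Finset.univ.filter fun e => y i e = b).card) ∧
      (∀ i, ∀ E ∈ S i, ∀ E' ∈ S i, TriangleFree (crossing (y i) E E')) ∧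
      ∀ E, TriangleFree E → ∃ i, E ∈ S i := by
  classical
  obtain ⟨δ, hδ, hδd⟩ := hd.exists_le
  -- With at most `s` terms all below `τ`, the output would be at most `δ / 2`; the `+ 1` covers `s
  -- = 0`.
  set τ : ℝ := δ / (2 * (s + 1)) with hτ
  have hτ0 : 0 < τ := by positivity
  -- The three bounds separate triangle-free graphs from the others, keep the output below 2, and
  -- give `2 * ε ≤ τ ^ 2`.
  set ε : ℝ := min (δ / 2) (min 1 (τ ^ 2 / 2)) with hε
  have hε0 : 0 < ε := by positivity
  have hε₁ : ε ≤ δ / 2 := min_le_left _ _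
  have hε₂ : ε ≤ 1 := (min_le_right _ _).trans (min_le_left _ _)
  have hε₃ : ε ≤ τ ^ 2 / 2 := (min_le_right _ _).trans (min_le_right _ _)
  obtain ⟨Φ, hD, hC, hsize, happ⟩ := hs ε hε0
  have hlow : ∀ E, TriangleFree E → δ / 2 < Φ.output E := fun E hE => by
    have h₁ := (abs_lt.1 (happ E)).1
    have h₂ := hδd E hE
    linarith
  have hhigh : ∀ E, ¬ TriangleFree E → Φ.output E < ε := fun E hE => by
    have h₁ := (abs_lt.1 (happ E)).2
    rw [hd.eq_zero hE] at h₁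
    linarith
  have htwo : ∀ E, Φ.output E < 2 := fun E => by
    have h₁ := (abs_lt.1 (happ E)).2
    have h₂ := hd.le_one E
    linarith
  have hroot : Φ.scope Φ.root = Set.univ := by
    refine Set.eq_univ_of_forall fun e => ?_
    by_contra he
    obtain ⟨E, hE, hE'⟩ := exists_triangleFree_update_not_triangleFree hM e
    have h₁ : Φ.output (Function.update E e true) = Φ.output E :=
      Φ.dependsOn_value Φ.root fun i hi =>
        Function.update_of_ne (fun h : i = e => he (h ▸ hi)) _ _
    have h₂ := hlow E hE
    have h₃ := hhigh _ hE'
    linarith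
  have hcard : 2 ≤ Nat.card (EdgeVar M) := by
    have := two_mul_card_edgeVar_add M
    rw [Nat.card_eq_fintype_card]
    nlinarith
  obtain ⟨κ, hκ, Y, g, h, hκs, hY, hg, hh, hgY, hhY, hout⟩ :=
    Φ.exists_balanced_decomposition hD hC hcard hroot
  have hterm : ∀ i E, g i E * h i E ≤ Φ.output E := fun i E => by
    rw [hout E]
    exact Finset.single_le_sum (f := fun i => g i E * h i E)
      (fun i _ => mul_nonneg (hg i E) (hh i E)) (Finset.mem_univ i)
  refine ⟨κ, hκ, fun i e => decide (e ∈ Y i), fun i => {E | τ ≤ g i E * h i E},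
    hκs.trans hsize, fun i b => ?_, fun i E hE E' hE' => ?_, fun E hE => ?_⟩
  · have h₁ : (Finset.univ.filter fun e => decide (e ∈ Y i) = true).card = (Y i).ncard := by
      rw [Set.ncard_eq_toFinset_card']
      congr 1
      ext e
      simp
    have h₂ := Finset.card_filter_add_card_filter_not (s := (Finset.univ : Finset (EdgeVar M)))
      (fun e => decide (e ∈ Y i) = true)
    have h₃ := hY i
    rw [Nat.card_eq_fintype_card] at h₃
    rw [Finset.card_univ] at h₂
    dsimp only
    cases b
    · simp only [Bool.not_eq_true] at h₂
      omega
    · omega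
  · by_contra hcon
    set y : EdgeVar M → Bool := fun e => decide (e ∈ Y i)
    have hgc : ∀ A B, g i (crossing y A B) = g i A := fun A B =>
      hgY i fun e he => by simp [crossing, y, he]
    have hhc : ∀ A B, h i (crossing y A B) = h i B := fun A B =>
      hhY i fun e he => by simp [crossing, y, (by simpa using he : e ∉ Y i)]
    have h₁ := (hterm i (crossing y E E')).trans_lt (hhigh _ hcon)
    have h₂ := (hterm i (crossing y E' E)).trans_lt (htwo _)
    rw [hgc, hhc] at h₁ h₂
    -- The same four factors, regrouped as the two crossings, have product below `2 * ε`.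
    have h₃ : τ * τ ≤ (g i E * h i E) * (g i E' * h i E') :=
      mul_le_mul hE hE' hτ0.le (hτ0.le.trans hE)
    have h₄ : (g i E * h i E') * (g i E' * h i E) ≤ (g i E * h i E') * 2 :=
      mul_le_mul_of_nonneg_left h₂.le (mul_nonneg (hg _ _) (hh _ _))
    nlinarith
  · by_contra! hcon
    have h₁ : Φ.output E ≤ Fintype.card κ * τ := by
      rw [hout E, ← nsmul_eq_mul, ← Finset.card_univ]
      exact Finset.sum_le_card_nsmul _ _ _ fun i _ => (not_le.1 (hcon i)).le
    have h₂ : (Fintype.card κ : ℝ) ≤ s + 1 := by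
      exact_mod_cast (hκs.trans hsize).trans (Nat.le_succ s)
    have h₃ : (s + 1 : ℝ) * τ = δ / 2 := by
      rw [hτ]
      field_simp
    have h₄ := hlow E hE
    have h₅ := mul_le_mul_of_nonneg_right h₂ hτ0.le
    linarith

end Approximation

theorem theorem2 :
    ∃ c : ℝ, 0 < c ∧ ∃ M₀ : ℕ, ∀ M : ℕ, M₀ ≤ M →
      ∀ d : (EdgeVar M → Bool) → ℝ, IsStrictlyPositiveTriangleFreeDist d →
        ∀ s : ℕ, ApproximableBySPN d s → (2 : ℝ) ^ (c * (M : ℝ)) ≤ (s : ℝ) := by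
  -- There are `M / 1200` triples, rounded down; from `M = 1200` on this is at least `M / 2400`.
  refine ⟨Real.logb 2 (96 / 95) / 2400, ?_, 1200, fun M hM d hd s hs => ?_⟩
  · exact div_pos (Real.logb_pos (by norm_num) (by norm_num)) (by norm_num)
  obtain ⟨κ, hκ, y, S, hcard, hy, hS, hcover⟩ := exists_crossing_cover (by omega) hd hs
  have h := pow_le_card_of_crossing_cover (by omega) y hy S hS hcover (m := M / 1200)
    (Nat.mul_div_le M 1200)
  have hexp : (M : ℝ) / 2400 ≤ (M / 1200 : ℕ) := by
    have : M ≤ 2400 * (M / 1200) := by omega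
    rw [div_le_iff₀ (by norm_num)]
    exact_mod_cast this.trans_eq (mul_comm _ _)
  calc (2 : ℝ) ^ (Real.logb 2 (96 / 95) / 2400 * (M : ℝ))
      = (96 / 95 : ℝ) ^ ((M : ℝ) / 2400) := by
        rw [div_mul_eq_mul_div, mul_div_assoc, Real.rpow_mul (by norm_num),
          Real.rpow_logb (by norm_num) (by norm_num) (by norm_num)]
    _ ≤ (96 / 95 : ℝ) ^ ((M / 1200 : ℕ) : ℝ) :=
        Real.rpow_le_rpow_of_exponent_le (by norm_num) hexp
    _ = (96 / 95 : ℝ) ^ (M / 1200) := Real.rpow_natCast _ _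
    _ ≤ Fintype.card κ := h
    _ ≤ s := by exact_mod_cast hcard
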